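/- All graphs are finite, simple and undirected. For a graph $G$ let $R(G)=\sum_{uv\in E(G)}\frac{1}{\sqrt{\deg_G(u)\deg_G(v)}}$ be its Randić index, let $n_i(G)$ be the number of vertices of degree $i$, and let $m_{i,j}(G)$ be the number of edges joining a vertex of degree $i$ with a vertex of degree $j$. A connected graph with $n$ vertices has cyclomatic number $c$ if it has $n+c-1$ edges. Let $\Omega_1(n)$ be the set of $n$-vertex graphs with $n_3=8$, $n_2=n-8$, $m_{3,3}=11$, $m_{2,3}=2$, $m_{2,2}=n-9$, and let $\Omega_3(n)$ be the set of $n$-vertex graphs with $n_3=10$, $n_2=n-10$, $m_{3,3}=14$, $m_{2,3}=2$, $m_{2,2}=n-11$. 1. Let $G$ be a connected graph with $n\ge 9$ vertices and cyclomatic number $5$. Then $R(G)\le \frac{n}{2}-\frac{5-2\sqrt6}{6}$, with equality if and only if $G\in\Omega_1(n)$. 2. Let $G$ be a connected graph with $n\ge 11$ vertices and cyclomatic number $6$. Then $R(G)\le \frac{n}{2}-\frac{5-2\sqrt6}{6}$, with equality if and only if $G\in\Omega_3(n)$. -/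

import Mathlib

namespace RandicOrder

variable {V : Type*} [Fintype V] [DecidableEq V]

/-- The Randić index: the sum over all edges `uv` of `1 / √(deg u * deg v)`. -/
noncomputable def randicIndex (G : SimpleGraph V) [DecidableRel G.Adj] : ℝ :=
  ∑ e ∈ G.edgeFinset,
    Sym2.lift ⟨fun u v => 1 / Real.sqrt ((G.degree u : ℝ) * (G.degree v : ℝ)),
      fun u v => by dsimp only; rw [mul_comm]⟩ e

/-- The number of vertices of degree `i`. -/
def numDegree (G : SimpleGraph V) [DecidableRel G.Adj] (i : ℕ) : ℕ :=
  (Finset.univ.filter fun v => G.degree v = i).card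

/-- The number of edges joining a vertex of degree `i` with a vertex of degree `j`. -/
def numEdge (G : SimpleGraph V) [DecidableRel G.Adj] (i j : ℕ) : ℕ :=
  (G.edgeFinset.filter fun e => Sym2.map (fun v => G.degree v) e = s(i, j)).card

/-- `G` is a connected graph with cyclomatic number `c`: it is connected and, if it has `n`
vertices, it has `n + c - 1` edges (written without subtraction). -/
def IsCyclicWith (G : SimpleGraph V) [DecidableRel G.Adj] (c : ℕ) : Prop :=
  G.Connected ∧ G.edgeFinset.card + 1 = Fintype.card V + c

/-- The class `Υ₁(n)`. -/
def Upsilon1 (G : SimpleGraph V) [DecidableRel G.Adj] (n : ℕ) : Prop :=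
  numDegree G 3 = 8 ∧ (numDegree G 2 : ℤ) = (n : ℤ) - 8

/-- The class `Υ₃(n)`. -/
def Upsilon3 (G : SimpleGraph V) [DecidableRel G.Adj] (n : ℕ) : Prop :=
  numDegree G 3 = 10 ∧ (numDegree G 2 : ℤ) = (n : ℤ) - 10

/-- The class `Ω₁(n)`. -/
def Omega1 (G : SimpleGraph V) [DecidableRel G.Adj] (n : ℕ) : Prop :=
  Upsilon1 G n ∧ numEdge G 3 3 = 11 ∧ numEdge G 2 3 = 2 ∧
    (numEdge G 2 2 : ℤ) = (n : ℤ) - 9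

/-- The class `Ω₃(n)`. -/
def Omega3 (G : SimpleGraph V) [DecidableRel G.Adj] (n : ℕ) : Prop :=
  Upsilon3 G n ∧ numEdge G 3 3 = 14 ∧ numEdge G 2 3 = 2 ∧
    (numEdge G 2 2 : ℤ) = (n : ℤ) - 11

end RandicOrder

namespace RandicOrder

open Finset

/-! Summing 1/deg u + 1/deg v over the edges uv gives n, so n - 2R is the sum over edges of (1/√deg
u - 1/√deg v)². Maximising R means minimising this total (`totalIrregularity_eq`). Degrees ≤ 2 and ≥
3 both occur, by counting edges. With minimum degree 2, the edges leaving the degree-2 vertices are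
at least one by connectivity and even in number by parity, hence at least two, each costing no less
than a 2-3 edge. If there is a leaf, a single edge from a leaf to a non-leaf costs more than that.
Equality leaves only degrees 2 and 3 and exactly two 2-3 edges; the remaining counts follow by
linear algebra. -/

/-- The squared difference of `1 / √i` and `1 / √j`. -/
noncomputable def irregularity : Sym2 ℕ → ℝ :=
  Sym2.lift ⟨fun i j => (1 / √(i : ℝ) - 1 / √(j : ℝ)) ^ 2, fun i j => by ring⟩

theorem irregularity_mk (i j : ℕ) :
    irregularity s(i, j) = (1 / √(i : ℝ) - 1 / √(j : ℝ)) ^ 2 := rfl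

theorem irregularity_nonneg (e : Sym2 ℕ) : 0 ≤ irregularity e := by
  induction e with
  | h i j => exact sq_nonneg _

theorem irregularity_self (i : ℕ) : irregularity s(i, i) = 0 := by
  simp [irregularity_mk]

theorem irregularity_mono {i j k : ℕ} (hi : 1 ≤ i) (hij : i ≤ j) (hjk : j ≤ k) :
    irregularity s(i, j) ≤ irregularity s(i, k) := by
  simp only [irregularity_mk]
  have hi' : (0 : ℝ) < i := by exact_mod_cast hi
  have hij' : (i : ℝ) ≤ j := by exact_mod_cast hij
  have hjk' : (j : ℝ) ≤ k := by exact_mod_cast hjk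
  have h1 : 1 / √(j : ℝ) ≤ 1 / √(i : ℝ) :=
    one_div_le_one_div_of_le (Real.sqrt_pos.2 hi') (Real.sqrt_le_sqrt hij')
  have h2 : 1 / √(k : ℝ) ≤ 1 / √(j : ℝ) :=
    one_div_le_one_div_of_le (Real.sqrt_pos.2 (hi'.trans_le hij')) (Real.sqrt_le_sqrt hjk')
  exact pow_le_pow_left₀ (by linarith) (by linarith) 2

theorem irregularity_pos {i j : ℕ} (hi : 1 ≤ i) (hij : i < j) : 0 < irregularity s(i, j) := by
  rw [irregularity_mk]
  have hi' : (0 : ℝ) < i := by exact_mod_cast hi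
  have hij' : (i : ℝ) < j := by exact_mod_cast hij
  have h1 : 1 / √(j : ℝ) < 1 / √(i : ℝ) :=
    one_div_lt_one_div_of_lt (Real.sqrt_pos.2 hi') (Real.sqrt_lt_sqrt hi'.le hij')
  exact pow_pos (by linarith) 2

theorem irregularity_eq {i j : ℕ} (hi : 1 ≤ i) (hj : 1 ≤ j) :
    irregularity s(i, j) = 1 / (i : ℝ) + 1 / (j : ℝ) - 2 * (1 / √((i : ℝ) * j)) := by
  have hi' : (0 : ℝ) ≤ i := by positivity
  have hj' : (0 : ℝ) ≤ j := by positivity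
  rw [irregularity_mk, Real.sqrt_mul hi', sub_sq, div_pow, div_pow, Real.sq_sqrt hi',
    Real.sq_sqrt hj', one_pow, mul_assoc, one_div_mul_one_div]
  ring

theorem irregularity_two_three : irregularity s(2, 3) = (5 - 2 * √6) / 6 := by
  rw [irregularity_eq (by norm_num) (by norm_num)]
  have h : √(6 : ℝ) ^ 2 = 6 := Real.sq_sqrt (by norm_num)
  have h0 : √(6 : ℝ) ≠ 0 := by positivity
  norm_num
  field_simp
  linarith

theorem two_mul_irregularity_two_three_lt_one_two :
    2 * irregularity s(2, 3) < irregularity s(1, 2) := by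
  rw [irregularity_two_three, irregularity_eq (by norm_num) (by norm_num)]
  have h2 : √(2 : ℝ) ^ 2 = 2 := Real.sq_sqrt (by norm_num)
  have h6 : (2.449 : ℝ) < √6 := Real.lt_sqrt_of_sq_lt (by norm_num)
  have h3 : 1 / √(2 : ℝ) < 1 / 1.4 :=
    one_div_lt_one_div_of_lt (by norm_num) (Real.lt_sqrt_of_sq_lt (by norm_num))
  norm_num at h3 h6 ⊢
  linarith

theorem two_mul_irregularity_two_three_lt_two_four :
    2 * irregularity s(2, 3) < irregularity s(2, 4) := by
  rw [irregularity_two_three, irregularity_eq (by norm_num) (by norm_num)]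
  have h6 : (2.449 : ℝ) < √6 := Real.lt_sqrt_of_sq_lt (by norm_num)
  have h3 : 1 / √(8 : ℝ) < 1 / 2.82 :=
    one_div_lt_one_div_of_lt (by norm_num) (Real.lt_sqrt_of_sq_lt (by norm_num))
  norm_num at h3 h6 ⊢
  linarith

theorem exists_adj_of_connected {V : Type*} {G : SimpleGraph V} (hG : G.Connected)
    (p : V → Prop) {a b : V} (ha : p a) (hb : ¬ p b) : ∃ u v, G.Adj u v ∧ p u ∧ ¬ p v := by
  obtain ⟨w⟩ := hG.preconnected a b
  obtain ⟨d, -, h1, h2⟩ := w.exists_boundary_dart {x | p x} ha hb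
  exact ⟨d.fst, d.snd, d.adj, h1, h2⟩

/-! ### Edge sums as vertex sums -/

variable {V : Type*} [Fintype V] (G : SimpleGraph V) [DecidableRel G.Adj]

/-- Summing `g u + g v` over the edges `uv` counts each vertex as often as its degree. -/
theorem sum_edgeFinset_add [DecidableEq V] {M : Type*} [AddCommMonoid M] (g : V → M) :
    ∑ e ∈ G.edgeFinset, Sym2.lift ⟨fun u v => g u + g v, fun _ _ => add_comm _ _⟩ e =
      ∑ v, G.degree v • g v := by
  have h : ∀ e ∈ G.edgeFinset,
      Sym2.lift ⟨fun u v => g u + g v, fun _ _ => add_comm _ _⟩ e =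
        ∑ x ∈ univ.filter (fun x => x ∈ e), g x := by
    intro e he
    induction e with
    | h u v =>
      have huv : u ≠ v := (show G.Adj u v by simpa using he).ne
      have : univ.filter (fun x => x ∈ s(u, v)) = {u, v} := by ext; simp
      rw [this, sum_pair huv]
      rfl
  rw [sum_congr rfl h, sum_comm' (t' := univ) (s' := fun v => G.incidenceFinset v)]
  · refine sum_congr rfl fun v _ => ?_
    rw [sum_const, G.card_incidenceFinset_eq_degree]
  · intro e v
    simp [SimpleGraph.mem_incidenceFinset, SimpleGraph.incidenceSet]

/-- The sum of the irregularities of the edges. -/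
noncomputable def totalIrregularity : ℝ :=
  ∑ e ∈ G.edgeFinset, irregularity (e.map fun v => G.degree v)

variable {G}

theorem totalIrregularity_eq [DecidableEq V] (hpos : ∀ v, 1 ≤ G.degree v) :
    totalIrregularity G = Fintype.card V - 2 * randicIndex G := by
  have h := sum_edgeFinset_add G fun v => 1 / (G.degree v : ℝ)
  have h' : ∑ v, G.degree v • (1 / (G.degree v : ℝ)) = Fintype.card V := by
    rw [sum_congr rfl fun v _ => (?_ : G.degree v • (1 / (G.degree v : ℝ)) = 1)]
    · simp
    · have : (G.degree v : ℝ) ≠ 0 := by exact_mod_cast Nat.ne_of_gt (hpos v)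
      rw [nsmul_eq_mul]
      field_simp
  rw [← h', ← h, totalIrregularity, randicIndex, mul_sum, ← sum_sub_distrib]
  refine sum_congr rfl fun e _ => ?_
  induction e with
  | h u v => exact irregularity_eq (hpos u) (hpos v)

theorem irregularity_le_totalIrregularity {u v : V} (h : G.Adj u v) :
    irregularity s(G.degree u, G.degree v) ≤ totalIrregularity G :=
  single_le_sum (f := fun e : Sym2 V => irregularity (e.map fun v => G.degree v))
    (fun _ _ => irregularity_nonneg _) (by simpa using h : s(u, v) ∈ G.edgeFinset)

/-! ### Edges leaving the degree-two vertices -/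

variable (G) in
/-- The edges with exactly one end of degree two. -/
def boundaryTwo : Finset (Sym2 V) :=
  G.edgeFinset.filter fun e => Odd (Sym2.lift ⟨fun u v =>
    (if G.degree u = 2 then 1 else 0) + (if G.degree v = 2 then 1 else 0),
    fun _ _ => add_comm _ _⟩ e)

theorem mem_boundaryTwo {u v : V} : s(u, v) ∈ boundaryTwo G ↔
    G.Adj u v ∧ (G.degree u = 2 ∧ G.degree v ≠ 2 ∨ G.degree u ≠ 2 ∧ G.degree v = 2) := by
  simp only [boundaryTwo, mem_filter, SimpleGraph.mem_edgeFinset, SimpleGraph.mem_edgeSet,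
    Sym2.lift_mk]
  by_cases hu : G.degree u = 2 <;> by_cases hv : G.degree v = 2 <;> simp [hu, hv]

/-- Modulo 2 this cardinality is the number of edge ends at degree-2 vertices, and each such vertex
contributes two ends. -/
theorem even_card_boundaryTwo [DecidableEq V] : Even (boundaryTwo G).card := by
  rw [boundaryTwo, ← even_sum_iff_even_card_odd,
    sum_edgeFinset_add G fun v => if G.degree v = 2 then 1 else 0]
  refine even_sum _ fun v _ => ?_
  by_cases hv : G.degree v = 2 <;> simp [hv]

theorem two_le_card_boundaryTwo [DecidableEq V] (hG : G.Connected) {a b : V} (ha : G.degree a = 2)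
    (hb : G.degree b ≠ 2) : 2 ≤ (boundaryTwo G).card := by
  obtain ⟨u, v, huv, hu, hv⟩ := exists_adj_of_connected hG (fun x => G.degree x = 2) ha hb
  have h0 : 0 < (boundaryTwo G).card :=
    card_pos.2 ⟨s(u, v), mem_boundaryTwo.2 ⟨huv, Or.inl ⟨hu, hv⟩⟩⟩
  obtain ⟨k, hk⟩ := even_card_boundaryTwo (G := G)
  omega

theorem irregularity_two_three_le_of_mem (hmin : ∀ v, 2 ≤ G.degree v) {e : Sym2 V}
    (he : e ∈ boundaryTwo G) :
    irregularity s(2, 3) ≤ irregularity (e.map fun v => G.degree v) := by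
  induction e with
  | h u v =>
    have hu := hmin u
    have hv := hmin v
    change _ ≤ irregularity s(G.degree u, G.degree v)
    rcases (mem_boundaryTwo.1 he).2 with ⟨h1, h2⟩ | ⟨h1, h2⟩
    · rw [h1]
      exact irregularity_mono (by norm_num) (by norm_num) (by omega)
    · rw [h2, Sym2.eq_swap (a := G.degree u)]
      exact irregularity_mono (by norm_num) (by norm_num) (by omega)

theorem two_mul_irregularity_le_sum_boundaryTwo [DecidableEq V] (hG : G.Connected)
    (hmin : ∀ v, 2 ≤ G.degree v) {a b : V} (ha : G.degree a = 2) (hb : G.degree b ≠ 2) :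
    2 * irregularity s(2, 3) ≤
      ∑ e ∈ boundaryTwo G, irregularity (e.map fun v => G.degree v) := by
  have h1 : (boundaryTwo G).card • irregularity s(2, 3) ≤
      ∑ e ∈ boundaryTwo G, irregularity (e.map fun v => G.degree v) :=
    card_nsmul_le_sum _ _ _ fun e he => irregularity_two_three_le_of_mem hmin he
  have h2 : (2 : ℝ) ≤ (boundaryTwo G).card := by
    exact_mod_cast two_le_card_boundaryTwo hG ha hb
  rw [nsmul_eq_mul] at h1
  have h3 := mul_le_mul_of_nonneg_right h2 (irregularity_nonneg s(2, 3))
  exact h3.trans h1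

theorem totalIrregularity_lower_bound [DecidableEq V] (hG : G.Connected)
    (hpos : ∀ v, 1 ≤ G.degree v) {a b : V} (ha : G.degree a ≤ 2) (hb : 3 ≤ G.degree b) :
    2 * irregularity s(2, 3) ≤ totalIrregularity G ∧
      (totalIrregularity G = 2 * irregularity s(2, 3) →
        ∀ v, G.degree v = 2 ∨ G.degree v = 3) := by
  by_cases hmin : ∀ v, 2 ≤ G.degree v
  · have hbd := two_mul_irregularity_le_sum_boundaryTwo hG hmin
      (show G.degree a = 2 from le_antisymm ha (hmin a)) (show G.degree b ≠ 2 by omega)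
    have hsub : boundaryTwo G ⊆ G.edgeFinset := filter_subset _ _
    refine ⟨hbd.trans (sum_le_sum_of_subset_of_nonneg hsub fun _ _ _ =>
      irregularity_nonneg _), fun heq => ?_⟩
    by_contra! hex
    obtain ⟨x, hx2, hx3⟩ := hex
    have hx := hmin x
    obtain ⟨u, v, huv, hu, hv⟩ := exists_adj_of_connected hG (fun y => G.degree y ≤ 3)
      (a := a) (b := x) (by omega) (by omega)
    have hu2 := hmin u
    rcases (by omega : G.degree u = 2 ∨ G.degree u = 3) with h | h
    -- A single edge from degree 2 to degree ≥ 4 already exceeds the cost of two 2-3 edges.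
    · have h1 := irregularity_le_totalIrregularity huv
      rw [h] at h1
      have h2 : irregularity s(2, 4) ≤ irregularity s(2, G.degree v) :=
        irregularity_mono (by norm_num) (by norm_num) (by omega)
      linarith [two_mul_irregularity_two_three_lt_two_four]
    -- An edge from degree 3 to degree ≥ 4 adds a positive cost on top of the boundary edges.
    · have hnot : s(u, v) ∉ boundaryTwo G := by
        rw [mem_boundaryTwo]
        omega
      have hpos' : 0 < irregularity s(G.degree u, G.degree v) :=
        irregularity_pos (by omega) (by omega)
      have hlt : ∑ e ∈ boundaryTwo G, irregularity (e.map fun v => G.degree v) <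
          totalIrregularity G :=
        sum_lt_sum_of_subset hsub (by simpa using huv : s(u, v) ∈ G.edgeFinset) hnot
          hpos' fun _ _ _ => irregularity_nonneg _
      linarith
  · push Not at hmin
    obtain ⟨x, hx⟩ := hmin
    have hx1 := hpos x
    obtain ⟨u, v, huv, hu, hv⟩ := exists_adj_of_connected hG (fun y => G.degree y = 1)
      (a := x) (b := b) (by omega) (by omega)
    have hv1 := hpos v
    have h1 := irregularity_le_totalIrregularity huv
    rw [hu] at h1
    have h2 : irregularity s(1, 2) ≤ irregularity s(1, G.degree v) :=
      irregularity_mono (by norm_num) (by norm_num) (by omega)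
    have h3 := two_mul_irregularity_two_three_lt_one_two
    exact ⟨by linarith, fun h => by linarith⟩

/-! ### Counting edges by end degrees -/

/-- If the edges all fall into the classes `s(2, 2)`, `s(2, 3)`, `s(3, 3)`, a sum over the edges of
a function of the end degrees is determined by the three numbers of edges. -/
theorem sum_edgeFinset_map_degree {M : Type*} [AddCommMonoid M] (f : Sym2 ℕ → M)
    (h : ∀ e ∈ G.edgeFinset, e.map (fun v => G.degree v) ∈
      ({s(2, 2), s(2, 3), s(3, 3)} : Finset (Sym2 ℕ))) :
    ∑ e ∈ G.edgeFinset, f (e.map fun v => G.degree v) =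
      numEdge G 2 2 • f s(2, 2) + numEdge G 2 3 • f s(2, 3) + numEdge G 3 3 • f s(3, 3) := by
  rw [← sum_fiberwise_of_maps_to h, sum_insert (by decide), sum_insert (by decide),
    sum_singleton, ← add_assoc]
  have key : ∀ i j : ℕ, ∑ e ∈ G.edgeFinset with e.map (fun v => G.degree v) = s(i, j),
      f (e.map fun v => G.degree v) = numEdge G i j • f s(i, j) := by
    intro i j
    rw [sum_congr rfl fun e he => by rw [(mem_filter.1 he).2], sum_const, numEdge]
  rw [key, key, key]

theorem map_degree_mem_of_forall (h : ∀ v, G.degree v = 2 ∨ G.degree v = 3) (e : Sym2 V) :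
    e.map (fun v => G.degree v) ∈ ({s(2, 2), s(2, 3), s(3, 3)} : Finset (Sym2 ℕ)) := by
  induction e with
  | h u v =>
    rw [Sym2.map_mk]
    rcases h u with hu | hu <;> rcases h v with hv | hv <;> rw [hu, hv] <;> decide

/-- The three classes are disjoint, so if their sizes add up to the number of edges, no other edge
remains. The converse direction can thus start from edge counts alone. -/
theorem map_degree_mem_of_card
    (h : G.edgeFinset.card = numEdge G 2 2 + numEdge G 2 3 + numEdge G 3 3) :
    ∀ e ∈ G.edgeFinset, e.map (fun v => G.degree v) ∈
      ({s(2, 2), s(2, 3), s(3, 3)} : Finset (Sym2 ℕ)) := by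
  have hsum : (G.edgeFinset.filter fun e => e.map (fun v => G.degree v) ∈
      ({s(2, 2), s(2, 3), s(3, 3)} : Finset (Sym2 ℕ))).card =
      numEdge G 2 2 + numEdge G 2 3 + numEdge G 3 3 := by
    rw [card_eq_sum_card_fiberwise (f := fun e : Sym2 V => e.map (fun v => G.degree v))
      (t := {s(2, 2), s(2, 3), s(3, 3)})
      fun e he => mem_coe.2 (mem_filter.1 (mem_coe.1 he)).2,
      sum_insert (by decide), sum_insert (by decide), sum_singleton, ← add_assoc]
    have key : ∀ i j : ℕ, s(i, j) ∈ ({s(2, 2), s(2, 3), s(3, 3)} : Finset (Sym2 ℕ)) →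
        ((G.edgeFinset.filter fun e => e.map (fun v => G.degree v) ∈
          ({s(2, 2), s(2, 3), s(3, 3)} : Finset (Sym2 ℕ))).filter
          fun e => e.map (fun v => G.degree v) = s(i, j)).card = numEdge G i j := by
      intro i j hij
      rw [filter_filter, numEdge]
      congr 1
      refine filter_congr fun e _ => ⟨fun h => h.2, fun h => ⟨by rwa [h], h⟩⟩
    rw [key 2 2 (by decide), key 2 3 (by decide), key 3 3 (by decide)]
  exact card_filter_eq_iff.1 (hsum.trans h.symm)

/-- The number of vertices of degree `i`, counted with multiplicity `i`, is the number of ends of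
degree `i` of edges. -/
theorem mul_numDegree_eq_sum [DecidableEq V] (i : ℕ) :
    i * numDegree G i = ∑ e ∈ G.edgeFinset,
      Sym2.lift ⟨fun a b => (if a = i then 1 else 0) + (if b = i then 1 else 0),
        fun _ _ => add_comm _ _⟩ (e.map fun v => G.degree v) := by
  have h := sum_edgeFinset_add G fun v => if G.degree v = i then 1 else 0
  have h' : ∑ v, G.degree v • (if G.degree v = i then 1 else 0) = i * numDegree G i := by
    rw [numDegree, card_filter, mul_sum]
    refine sum_congr rfl fun v _ => ?_
    by_cases hv : G.degree v = i <;> simp [hv]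
  rw [← h', ← h]
  refine sum_congr rfl fun e _ => ?_
  induction e with
  | h u v => rfl

/-- Both parts are instances of this: c = 5 gives the counts 8, 11, 9 and c = 6 gives 10, 14, 11. -/
theorem randicIndex_bound [DecidableEq V] {c : ℕ} (hc : 2 ≤ c) (hcard : 2 * c - 1 ≤ Fintype.card V)
    (hG : IsCyclicWith G c) :
    randicIndex G ≤ 1 / 2 * (Fintype.card V : ℝ) - (5 - 2 * √6) / 6 ∧
    (randicIndex G = 1 / 2 * (Fintype.card V : ℝ) - (5 - 2 * √6) / 6 ↔
      numDegree G 3 = 2 * c - 2 ∧ numDegree G 2 + (2 * c - 2) = Fintype.card V ∧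
      numEdge G 3 3 = 3 * c - 4 ∧ numEdge G 2 3 = 2 ∧
      numEdge G 2 2 + (2 * c - 1) = Fintype.card V) := by
  obtain ⟨hconn, hedge⟩ := hG
  have : Nontrivial V := Fintype.one_lt_card_iff_nontrivial.1 (by omega)
  have hpos : ∀ v, 1 ≤ G.degree v := fun v => hconn.preconnected.degree_pos_of_nontrivial v
  have hdeg := G.sum_degrees_eq_twice_card_edges
  -- Otherwise 3n ≤ 2(n + c - 1), that is n ≤ 2c - 2.
  obtain ⟨a, ha⟩ : ∃ a, G.degree a ≤ 2 := by
    by_contra! h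
    have := card_nsmul_le_sum univ (fun v => G.degree v) 3 fun v _ => h v
    rw [card_univ, smul_eq_mul] at this
    omega
  -- Otherwise 2(n + c - 1) ≤ 2n, that is c ≤ 1.
  obtain ⟨b, hb⟩ : ∃ b, 3 ≤ G.degree b := by
    by_contra! h
    have := sum_le_card_nsmul univ (fun v => G.degree v) 2 fun v _ => Nat.le_of_lt_succ (h v)
    rw [card_univ, smul_eq_mul] at this
    omega
  obtain ⟨hle, heq⟩ := totalIrregularity_lower_bound hconn hpos ha hb
  have htot := totalIrregularity_eq hpos
  rw [irregularity_two_three] at hle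
  refine ⟨by linarith, fun h => ?_, ?_⟩
  · have hS : totalIrregularity G = 2 * irregularity s(2, 3) := by
      rw [irregularity_two_three]
      linarith
    have h23 := heq hS
    have hmem := fun e (_ : e ∈ G.edgeFinset) => map_degree_mem_of_forall h23 e
    have hw := sum_edgeFinset_map_degree irregularity hmem
    rw [irregularity_self, irregularity_self, smul_zero, smul_zero, zero_add, add_zero,
      nsmul_eq_mul] at hw
    have hm23 : numEdge G 2 3 = 2 := by
      have : (numEdge G 2 3 : ℝ) * irregularity s(2, 3) = 2 * irregularity s(2, 3) :=
        hw.symm.trans hS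
      exact_mod_cast mul_right_cancel₀ (irregularity_pos (by norm_num) (by norm_num)).ne' this
    have h2 := mul_numDegree_eq_sum (G := G) 2
    have h3 := mul_numDegree_eq_sum (G := G) 3
    have hm := sum_edgeFinset_map_degree (fun _ => 1) hmem
    rw [sum_edgeFinset_map_degree _ hmem] at h2 h3
    have hn : numDegree G 2 + numDegree G 3 = Fintype.card V := by
      rw [numDegree, numDegree, ← card_univ, ← card_union_of_disjoint]
      · congr 1
        ext v
        simpa using h23 v
      · exact disjoint_filter.2 fun v _ h h' => by omega
    -- What remains is linear: 2n₂ = 2m₂₂ + m₂₃, 3n₃ = m₂₃ + 2m₃₃, n₂ + n₃ = n and m₂₂ + m₂₃ + m₃₃ =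
    -- n + c - 1, with m₂₃ = 2.
    simp at h2 h3 hm
    omega
  · rintro ⟨-, -, h33, h23, h22⟩
    have hw := sum_edgeFinset_map_degree irregularity (map_degree_mem_of_card (G := G) (by omega))
    rw [irregularity_self, irregularity_self, smul_zero, smul_zero, zero_add, add_zero,
      nsmul_eq_mul, h23, irregularity_two_three] at hw
    have : totalIrregularity G = (2 : ℕ) * ((5 - 2 * √6) / 6) := hw
    push_cast at this
    linarith

end RandicOrder

theorem mainTheorem4 {V : Type*} [Fintype V] [DecidableEq V]
    (G : SimpleGraph V) [DecidableRel G.Adj] (n : ℕ) (hn : Fintype.card V = n) :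
    (9 ≤ n → RandicOrder.IsCyclicWith G 5 →
      RandicOrder.randicIndex G ≤ (1 / 2 : ℝ) * (n : ℝ) - (5 - 2 * Real.sqrt 6) / 6 ∧
      (RandicOrder.randicIndex G = (1 / 2 : ℝ) * (n : ℝ) - (5 - 2 * Real.sqrt 6) / 6 ↔
        RandicOrder.Omega1 G n)) ∧
    (11 ≤ n → RandicOrder.IsCyclicWith G 6 →
      RandicOrder.randicIndex G ≤ (1 / 2 : ℝ) * (n : ℝ) - (5 - 2 * Real.sqrt 6) / 6 ∧
      (RandicOrder.randicIndex G = (1 / 2 : ℝ) * (n : ℝ) - (5 - 2 * Real.sqrt 6) / 6 ↔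
        RandicOrder.Omega3 G n)) := by
  subst hn
  refine ⟨fun h9 hG => ?_, fun h11 hG => ?_⟩
  · obtain ⟨hle, hiff⟩ := RandicOrder.randicIndex_bound (by norm_num) (by omega) hG
    refine ⟨hle, hiff.trans ?_⟩
    unfold RandicOrder.Omega1 RandicOrder.Upsilon1
    omega
  · obtain ⟨hle, hiff⟩ := RandicOrder.randicIndex_bound (by norm_num) (by omega) hG
    refine ⟨hle, hiff.trans ?_⟩
    unfold RandicOrder.Omega3 RandicOrder.Upsilon3
    omega
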